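/- Write $2^{<\omega}$ for the set of finite binary strings, $2^\omega$ for the set of infinite binary sequences, $X{\upharpoonright}n$ for the initial segment of length $n$ of $X\in 2^\omega$, and $\#_i(\sigma)$ for the number of occurrences of the bit $i$ in a string $\sigma$. For an integer $k\ge 1$ let $\ell_k(\sigma)=\#_0(\sigma)+k\,\#_1(\sigma)$ be the $k$-length of $\sigma$, let $p_k$ be the unique $p\in(0,1)$ with $p^k+p-1=0$, and let $\lambda_k$ be the Bernoulli measure on $2^\omega$ given on cylinders by $\lambda_k(\sigma)=p_k^{\#_0(\sigma)}(1-p_k)^{\#_1(\sigma)}$. A prefix-free machine is a partial computable function $M$ from $2^{<\omega}$ to $2^{<\omega}$ whose domain contains no two strings one of which properly extends the other. A prefix-free machine $U$ is universal if for every prefix-free machine $M$ there is a string $\rho_M$ with $U(\rho_M{}^\smallfrown\sigma)=M(\sigma)$ for all $\sigma\in\mathrm{dom}(M)$. For such a $U$ let $K^{(k)}(\sigma)=\min\{\ell_k(\tau): U(\tau)=\sigma\}$. A $\lambda_k$-Martin-Löf test is a uniformly $\Sigma^0_1$ sequence $(\mathcal U_i)_{i\in\omega}$ of subsets of $2^\omega$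 with $\lambda_k(\mathcal U_i)\le 2^{-i}$ for all $i$, and $X$ is $\lambda_k$-Martin-Löf random if $X\notin\bigcap_i\mathcal U_i$ for every such test. **Corollary.** Let $U$ be a universal prefix-free machine. For every $X\in 2^\omega$ and every integer $k\ge 1$, $X$ is $\lambda_k$-Martin-Löf random if and only if there is a constant $c\in\omega$ such that for all $n\in\omega$ $$K^{(k)}(X{\upharpoonright}n)\ \ge\ \ell_k(X{\upharpoonright}n)-c .$$ -/

import Mathlib

open MeasureTheory ProbabilityTheory

noncomputable section

namespace KLength

/-! Finite binary strings are `List Bool` and infinite binary sequences are `ℕ → Bool`;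
`false` stands for the bit 0 and `true` for the bit 1. -/

/-- The initial segment of `X` of length `n`. -/
def initSeg (X : ℕ → Bool) (n : ℕ) : List Bool := (List.range n).map X

/-! ### Prefix-free machines and complexity -/

/-- No member of `S` properly extends another member of `S`. -/
def IsPrefixFree (S : Set (List Bool)) : Prop :=
  ∀ σ ∈ S, ∀ τ ∈ S, σ <+: τ → σ = τ

/-- A prefix-free machine: a partial computable function on strings with prefix-free domain. -/
structure IsPrefixFreeMachine (M : List Bool →. List Bool) : Prop where
  partrec : Partrec M
  prefixFree : IsPrefixFree M.Dom

/-- A universal prefix-free machine: a prefix-free machine `U` such that every prefix-free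
machine `M` has a coding string `ρ` with `U (ρ ++ σ) = M σ` for all `σ` in the domain of `M`. -/
structure IsUniversalPrefixFree (U : List Bool →. List Bool) : Prop where
  machine : IsPrefixFreeMachine U
  universal : ∀ M : List Bool →. List Bool, IsPrefixFreeMachine M →
    ∃ ρ : List Bool, ∀ σ ∈ M.Dom, U (ρ ++ σ) = M σ

/-! ### Existence of a universal prefix-free machine -/

section Existence

open Nat.Partrec (Code)
open Encodable

/-- The `n`-th step of a dovetailed search through the graph of the `e`-th partial computable
function: the input and the output found, if any. -/
def codeEvent (e n : ℕ) : Option (List Bool × List Bool) :=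
  (decode (α := List Bool) n.unpair.1).bind fun σ =>
    (Code.evaln n.unpair.2 (Denumerable.ofNat Code e) (encode σ)).bind fun m =>
      (decode (α := List Bool) m).map fun y => (σ, y)

/-- Two found inputs are distinct and comparable. -/
def clashB (o o' : Option (List Bool × List Bool)) : Bool :=
  (o.bind fun a => o'.map fun b =>
    !decide (a.1 = b.1) && (decide (a.1 = b.1.take a.1.length) || decide (b.1 = a.1.take b.1.length))).getD false

lemma clashB_primrec : Primrec₂ clashB := by
  unfold clashB
  refine Primrec.option_getD.comp ?_ (Primrec.const false)
  refine Primrec.option_bind .fst ?_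
  refine Primrec.option_map (Primrec.snd.comp .fst) ?_
  have ha : Primrec fun p : ((Option (List Bool × List Bool) × Option (List Bool × List Bool)) × (List Bool × List Bool)) × (List Bool × List Bool) => p.1.2.1 :=
    .comp .fst (.comp .snd .fst)
  have hb : Primrec fun p : ((Option (List Bool × List Bool) × Option (List Bool × List Bool)) × (List Bool × List Bool)) × (List Bool × List Bool) => p.2.1 :=
    .comp .fst .snd
  refine Primrec.and.comp (Primrec.not.comp (Primrec.eq.decide.comp ha hb)) (Primrec.or.comp ?_ ?_)
  · exact Primrec.eq.decide.comp ha (Primrec.list_take.comp (Primrec.list_length.comp ha) hb)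
  · exact Primrec.eq.decide.comp hb (Primrec.list_take.comp (Primrec.list_length.comp hb) ha)

lemma clashB_some (a b : List Bool × List Bool) :
    clashB (some a) (some b) = true ↔ a.1 ≠ b.1 ∧ (a.1 <+: b.1 ∨ b.1 <+: a.1) := by
  simp [clashB, List.prefix_iff_eq_take]

lemma codeEvent_primrec : Primrec₂ codeEvent := by
  unfold codeEvent
  refine Primrec.option_bind (Primrec.decode.comp (Primrec.fst.comp (Primrec.unpair.comp .snd))) ?_
  refine Primrec.option_bind ?_ ?_
  · exact Code.primrec_evaln.comp (Primrec.pair (Primrec.pair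
      (Primrec.snd.comp (Primrec.unpair.comp (Primrec.snd.comp .fst)))
      ((Primrec.ofNat Code).comp (Primrec.fst.comp .fst))) (Primrec.encode.comp .snd))
  · refine Primrec.option_map (Primrec.decode.comp .snd) ?_
    exact Primrec.pair (Primrec.snd.comp (Primrec.fst.comp .fst)) .snd

/-- Output at stage `n` of the `e`-th machine on `σ`. -/
def stage (e : ℕ) (σ : List Bool) (n : ℕ) : Option (List Bool) :=
  (codeEvent e n).bind fun p =>
    if p.1 = σ ∧ ∀ m < n, clashB (codeEvent e m) (codeEvent e n) = false then some p.2 else none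

lemma stage_primrec : Primrec fun q : (ℕ × List Bool) × ℕ => stage q.1.1 q.1.2 q.2 := by
  unfold stage
  refine Primrec.option_bind (codeEvent_primrec.comp (Primrec.fst.comp .fst) .snd) ?_
  refine Primrec.ite (PrimrecPred.and ?_ ?_) (Primrec.option_some.comp (Primrec.snd.comp .snd)) (.const none)
  · exact Primrec.eq.comp (Primrec.fst.comp .snd) (Primrec.snd.comp (Primrec.fst.comp .fst))
  · have : PrimrecRel fun (m : ℕ) (q : ((ℕ × List Bool) × ℕ) × (List Bool × List Bool)) =>
        clashB (codeEvent q.1.1.1 m) (codeEvent q.1.1.1 q.1.2) = false := by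
      refine Primrec.eq.comp (clashB_primrec.comp ?_ ?_) (.const false)
      · exact codeEvent_primrec.comp (Primrec.fst.comp (Primrec.fst.comp (Primrec.fst.comp .snd))) .fst
      · exact codeEvent_primrec.comp (Primrec.fst.comp (Primrec.fst.comp (Primrec.fst.comp .snd)))
          (Primrec.snd.comp (Primrec.fst.comp .snd))
    exact (this.forall_mem_list.comp (Primrec.list_range.comp (Primrec.snd.comp .fst))
      Primrec.id).of_eq fun q => by simp

lemma stage_eq_some {e σ n y} : stage e σ n = some y ↔
    codeEvent e n = some (σ, y) ∧ ∀ m < n, clashB (codeEvent e m) (codeEvent e n) = false := by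
  unfold stage
  cases h : codeEvent e n with
  | none => simp
  | some p =>
    obtain ⟨a, b⟩ := p
    by_cases h1 : a = σ <;> by_cases h2 : ∀ m < n, clashB (codeEvent e m) (some (a, b)) = false <;>
      simp_all [and_comm]

/-- The `e`-th prefix-free machine. -/
def pfMachine (e : ℕ) (σ : List Bool) : Part (List Bool) := Nat.rfindOpt (stage e σ)

lemma pfMachine_dom {e σ} : (pfMachine e σ).Dom ↔ ∃ n y, stage e σ n = some y := by
  simp [pfMachine, Nat.rfindOpt_dom]

lemma pfMachine_prefixFree (e : ℕ) : IsPrefixFree {σ | (pfMachine e σ).Dom} := by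
  intro σ hσ τ hτ h
  obtain ⟨n, y, hn⟩ := pfMachine_dom.1 hσ
  obtain ⟨m, z, hm⟩ := pfMachine_dom.1 hτ
  rw [stage_eq_some] at hn hm
  by_contra hne
  rcases lt_trichotomy n m with hlt | heq | hlt
  · have := hm.2 n hlt
    rw [hn.1, hm.1, ← Bool.not_eq_true, clashB_some] at this
    exact this ⟨hne, .inl h⟩
  · subst heq
    have := hn.1.symm.trans hm.1
    simp at this
    exact hne this.1
  · have := hn.2 m hlt
    rw [hn.1, hm.1, ← Bool.not_eq_true, clashB_some] at this
    exact this ⟨fun h => hne h.symm, .inr h⟩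

lemma codeEvent_sound {M : List Bool →. List Bool} {e : ℕ}
    (he : (Denumerable.ofNat Code e).eval =
      fun n => Part.bind (decode (α := List Bool) n) fun a => (M a).map encode)
    {n σ y} (h : codeEvent e n = some (σ, y)) : y ∈ M σ := by
  simp only [codeEvent, Option.bind_eq_some_iff, Option.map_eq_some_iff, Prod.mk.injEq] at h
  obtain ⟨σ', -, m, hm, y', hy', rfl, rfl⟩ := h
  have := Code.evaln_sound hm
  rw [he] at this
  simp at this
  obtain ⟨a, ha, rfl⟩ := this
  simp at hy'
  exact hy' ▸ ha

lemma codeEvent_complete {M : List Bool →. List Bool} {e : ℕ}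
    (he : (Denumerable.ofNat Code e).eval =
      fun n => Part.bind (decode (α := List Bool) n) fun a => (M a).map encode)
    {σ y} (h : y ∈ M σ) : ∃ n, codeEvent e n = some (σ, y) := by
  have : encode y ∈ (Denumerable.ofNat Code e).eval (encode σ) := by
    rw [he]; simpa using h
  obtain ⟨s, hs⟩ := Code.evaln_complete.1 this
  refine ⟨Nat.pair (encode σ) s, ?_⟩
  simp [codeEvent, Option.mem_def.1 hs]

lemma exists_pfMachine (M : List Bool →. List Bool) (hM : IsPrefixFreeMachine M) :
    ∃ e, ∀ σ, pfMachine e σ = M σ := by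
  obtain ⟨c, hc⟩ := Code.exists_code.1 hM.partrec
  refine ⟨encode c, fun σ => ?_⟩
  have he : (Denumerable.ofNat Code (encode c)).eval =
      fun n => Part.bind (decode (α := List Bool) n) fun a => (M a).map encode := by
    rw [Denumerable.ofNat_encode]; exact hc
  have key : ∀ y, y ∈ pfMachine (encode c) σ → y ∈ M σ := by
    intro y hy
    obtain ⟨n, hn⟩ := Nat.rfindOpt_spec hy
    exact codeEvent_sound he (stage_eq_some.1 hn).1
  refine Part.ext fun y => ⟨key y, fun hy => ?_⟩
  obtain ⟨n, hn⟩ := codeEvent_complete he hy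
  have hd : (pfMachine (encode c) σ).Dom := by
    refine pfMachine_dom.2 ⟨n, y, stage_eq_some.2 ⟨hn, fun m _ => ?_⟩⟩
    cases hm : codeEvent (encode c) m with
    | none => simp [clashB]
    | some p =>
      obtain ⟨τ, z⟩ := p
      have h1 := Part.dom_iff_mem.2 ⟨_, codeEvent_sound he hm⟩
      have h2 := Part.dom_iff_mem.2 ⟨_, hy⟩
      rw [hn, ← Bool.not_eq_true, clashB_some]
      rintro ⟨hne, h | h⟩
      · exact hne (hM.prefixFree _ h1 _ h2 h)
      · exact hne (hM.prefixFree _ h2 _ h1 h).symm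
  obtain ⟨z, hz⟩ := Part.dom_iff_mem.1 hd
  rwa [← Part.mem_unique (key z hz) hy]

/-- The machine with `U (0 ^ e 1 σ) = M_e σ`, where `M_e` is the `e`-th prefix-free machine. -/
def stdMachine (τ : List Bool) : Part (List Bool) :=
  Nat.rfindOpt fun n =>
    if τ.idxOf true < τ.length then stage (τ.idxOf true) (τ.drop (τ.idxOf true + 1)) n else none

lemma stdMachine_eq (τ : List Bool) : stdMachine τ =
    if τ.idxOf true < τ.length then pfMachine (τ.idxOf true) (τ.drop (τ.idxOf true + 1))
    else Part.none := by
  unfold stdMachine pfMachine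
  split_ifs with h
  · rfl
  · rw [Part.eq_none_iff']
    simp [Nat.rfindOpt_dom]

lemma stdMachine_append (e : ℕ) (σ : List Bool) :
    stdMachine (List.replicate e false ++ true :: σ) = pfMachine e σ := by
  have h : (List.replicate e false ++ true :: σ).idxOf true = e := by
    rw [List.idxOf_append_of_notMem (by simp)]
    simp
  rw [stdMachine_eq, h]
  simp [List.drop_append]

lemma eq_of_idxOf_lt {τ : List Bool} (h : τ.idxOf true < τ.length) :
    τ = List.replicate (τ.idxOf true) false ++ true :: τ.drop (τ.idxOf true + 1) := by
  induction τ with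
  | nil => simp at h
  | cons b τ ih =>
    cases b with
    | true => simp
    | false =>
      simp at h ⊢
      simpa [List.replicate_succ] using ih (by simpa using h)

/-- There is a universal prefix-free machine. -/
theorem exists_universalPrefixFree : ∃ U, IsUniversalPrefixFree U := by
  refine ⟨stdMachine, ⟨?_, ?_⟩, ?_⟩
  · refine Partrec.rfindOpt (Primrec.to_comp ?_)
    have hi : Primrec fun q : List Bool × ℕ => q.1.idxOf true :=
      Primrec.list_idxOf.comp (.const true) .fst
    refine Primrec.ite (Primrec.nat_lt.comp hi (Primrec.list_length.comp .fst)) ?_ (.const none)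
    exact stage_primrec.comp (.pair (.pair hi
      (Primrec.list_drop.comp (Primrec.succ.comp hi) .fst)) .snd)
  · intro σ hσ τ hτ h
    replace hσ : (stdMachine σ).Dom := hσ
    replace hτ : (stdMachine τ).Dom := hτ
    rw [stdMachine_eq] at hσ hτ
    split_ifs at hσ with h1
    · split_ifs at hτ with h2
      · have hi : τ.idxOf true = σ.idxOf true := by
          obtain ⟨t, rfl⟩ := h
          exact List.idxOf_append_of_mem (List.idxOf_lt_length_iff.1 h1)
        rw [hi] at hτ
        have := pfMachine_prefixFree _ _ hσ _ hτ (by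
          obtain ⟨t, rfl⟩ := h
          rw [List.drop_append_of_le_length (by omega)]
          exact List.prefix_append _ _)
        rw [eq_of_idxOf_lt h1, eq_of_idxOf_lt h2, hi, this]
      · exact hτ.elim
    · exact hσ.elim
  · intro M hM
    obtain ⟨e, he⟩ := exists_pfMachine M hM
    refine ⟨List.replicate e false ++ [true], fun σ _ => ?_⟩
    rw [List.append_assoc]
    exact (stdMachine_append e σ).trans (he σ)

end Existence

/-! ### The `k`-length and the `k`-complexity -/

/-- The `k`-length of a string: each 0 costs one, each 1 costs `k`. -/
def kLength (k : ℕ) (σ : List Bool) : ℕ := σ.count false + k * σ.count true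

/-- The prefix-free complexity of `σ` relative to the machine `M` and the length function `ℓ`:
the least `ℓ τ` over the inputs `τ` with `M τ = σ` (`⊤` when there is no such input). -/
def complexity (ℓ : List Bool → ℕ) (M : List Bool →. List Bool) (σ : List Bool) : ℕ∞ :=
  ⨅ τ ∈ {τ : List Bool | σ ∈ M τ}, (ℓ τ : ℕ∞)

/-- The `k`-complexity relative to the machine `U`. -/
def kComplexity (k : ℕ) (U : List Bool →. List Bool) (σ : List Bool) : ℕ∞ :=
  complexity (kLength k) U σ

/-! ### The Bernoulli measures `λ_k` -/

lemma existsUnique_root (k : ℕ) (hk : 1 ≤ k) :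
    ∃! x : ℝ, x ∈ Set.Ioo (0 : ℝ) 1 ∧ x ^ k + x - 1 = 0 := by
  have hk0 : k ≠ 0 := by omega
  have hc : ContinuousOn (fun x : ℝ => x ^ k + x - 1) (Set.Icc 0 1) := by fun_prop
  have h := intermediate_value_Ioo (zero_le_one' ℝ) hc
  have h0 : (0 : ℝ) ∈ Set.Ioo ((0 : ℝ) ^ k + 0 - 1) ((1 : ℝ) ^ k + 1 - 1) := by
    simp [hk0]
  obtain ⟨x, hx, hx0⟩ := h h0
  refine ⟨x, ⟨hx, hx0⟩, ?_⟩
  rintro y ⟨hy, hy0⟩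
  simp only at hx0
  rcases lt_trichotomy y x with hlt | heq | hlt
  · have := pow_lt_pow_left₀ hlt hy.1.le hk0
    linarith
  · exact heq
  · have := pow_lt_pow_left₀ hlt hx.1.le hk0
    linarith

/-- The unique `p ∈ (0, 1)` with `p ^ k + p - 1 = 0`. -/
def pRoot (k : ℕ) (hk : 1 ≤ k) : ℝ := (existsUnique_root k hk).choose

lemma pRoot_mem_Ioo (k : ℕ) (hk : 1 ≤ k) : pRoot k hk ∈ Set.Ioo (0 : ℝ) 1 :=
  (existsUnique_root k hk).choose_spec.1.1

lemma pRoot_eq (k : ℕ) (hk : 1 ≤ k) : pRoot k hk ^ k + pRoot k hk - 1 = 0 :=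
  (existsUnique_root k hk).choose_spec.1.2

/-- The measure `λ_k`: the bits are independent, each of them 0 with probability `pRoot k`. -/
def lambdaMeasure (k : ℕ) (hk : 1 ≤ k) : Measure (ℕ → Bool) :=
  Measure.infinitePi fun _ : ℕ =>
    bernoulliMeasure false true ⟨pRoot k hk, Set.Ioo_subset_Icc_self (pRoot_mem_Ioo k hk)⟩

/-- `λ_k` of the cylinder of `σ` is `p_k ^ ℓ_k(σ)`. -/
theorem lambdaMeasure_cylinder (k : ℕ) (hk : 1 ≤ k) (σ : List Bool) :
    lambdaMeasure k hk {X | initSeg X σ.length = σ} =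
      ENNReal.ofReal (pRoot k hk) ^ (kLength k σ) := by
  have hp := pRoot_mem_Ioo k hk
  have hq : 1 - pRoot k hk = pRoot k hk ^ k := by have := pRoot_eq k hk; linarith
  have hset : {X : ℕ → Bool | initSeg X σ.length = σ} =
      Set.pi (Finset.range σ.length : Set ℕ) (fun i => {σ.getD i false}) := by
    ext X
    simp only [initSeg, Set.mem_ofPred_eq, Set.mem_pi, Finset.coe_range, Set.mem_Iio, Set.mem_singleton_iff]
    rw [List.ext_getElem_iff]
    simp
    exact forall_congr' fun n => ⟨fun h hn => by simpa [hn] using h hn, fun h hn => by simpa [hn] using h hn⟩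
  rw [hset, lambdaMeasure, Measure.infinitePi_pi _ (fun _ _ => .of_discrete)]
  have hb : ∀ b : Bool, bernoulliMeasure false true
      (⟨pRoot k hk, Set.Ioo_subset_Icc_self (pRoot_mem_Ioo k hk)⟩ : unitInterval) {b} =
      ENNReal.ofReal (pRoot k hk) ^ (kLength k [b]) := by
    intro b
    rw [bernoulliMeasure_apply _ (.of_discrete)]
    cases b
    · simp [kLength]
      rw [ENNReal.ofReal, Real.toNNReal_of_nonneg hp.1.le]; rfl
    · simp [kLength]
      rw [← ENNReal.ofReal_pow hp.1.le, ← hq, ENNReal.ofReal, Real.toNNReal_of_nonneg (by linarith [hp.2])]; rfl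
  simp only [hb]
  induction σ using List.reverseRecOn with
  | nil => simp [kLength]
  | append_singleton σ b ih =>
    rw [List.length_append, List.length_singleton, Finset.prod_range_succ]
    have : ∏ x ∈ Finset.range σ.length, ENNReal.ofReal (pRoot k hk) ^ kLength k [(σ ++ [b]).getD x false] =
       ENNReal.ofReal (pRoot k hk) ^ kLength k σ := by
      rw [← ih]
      · refine Finset.prod_congr rfl fun x hx => ?_
        rw [List.getD_append _ _ _ _ (Finset.mem_range.1 hx)]
      · ext X
        simp only [initSeg, Set.mem_ofPred_eq, Set.mem_pi, Finset.coe_range, Set.mem_Iio, Set.mem_singleton_iff]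
        rw [List.ext_getElem_iff]
        simp
        exact forall_congr' fun n => ⟨fun h hn => by simpa [hn] using h hn, fun h hn => by simpa [hn] using h hn⟩
    rw [this, ← pow_add]
    congr 1
    simp [kLength]
    ring

/-! ### Martin-Löf randomness -/

/-- The open set of sequences that have an initial segment in `S`. -/
def openSet (S : Set (List Bool)) : Set (ℕ → Bool) := {X | ∃ n, initSeg X n ∈ S}

/-- A uniformly `Σ⁰₁` sequence of subsets of Cantor space. -/
def IsUniformlySigma01 (𝒰 : ℕ → Set (ℕ → Bool)) : Prop :=
  ∃ R : ℕ → Set (List Bool),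
    REPred (fun q : ℕ × List Bool => q.2 ∈ R q.1) ∧ ∀ i, 𝒰 i = openSet (R i)

/-- A Martin-Löf test with respect to `μ`. -/
structure IsMLTest (μ : Measure (ℕ → Bool)) (𝒰 : ℕ → Set (ℕ → Bool)) : Prop where
  sigma : IsUniformlySigma01 𝒰
  measure_le : ∀ i, μ (𝒰 i) ≤ (2⁻¹ : ENNReal) ^ i

/-- `X` is Martin-Löf random with respect to `μ`: it passes every test. -/
def IsMLRandom (μ : Measure (ℕ → Bool)) (X : ℕ → Bool) : Prop :=
  ∀ 𝒰 : ℕ → Set (ℕ → Bool), IsMLTest μ 𝒰 → X ∉ ⋂ i, 𝒰 i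

end KLength

end

noncomputable section

namespace KLength

open Nat.Partrec (Code)
open Encodable

/-! Write p for `pRoot k hk` and |σ| for the k-length. Since 1 - p = p ^ k, the cylinder of σ has
measure p ^ |σ|, so p ^ |σ| plays the role of 2 ^ (-length) in the classical theorem of Levin and
Schnorr. A prefix-free set has total weight at most 1 (Kraft).

If X is random, then complexity cannot fall far below k-length. The strings with a description
shorter by more than d generate an open set of measure at most p ^ d times the Kraft sum of the
domain (`lambdaMeasure_compressible_le`); letting d run through multiples of a suitable constant
gives a test, which X must pass.

Conversely, a test yields a machine that compresses the initial segments of every sequence it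
captures. Component i of a sped-up test has measure at most p ^ (2 * i) and a prefix-free generating
set (`openSet_minCovered`). Each generator σ can therefore ask for a code of k-length |σ| + C - i,
the weights of all requests still adding up to less than 1 - p. `exists_machine_of_requests` meets
the requests, and universality transfers the codes to U.

The new point is this Kraft–Chaitin theorem when a 1 costs k. Splitting a string obeys p ^ |ρ| = p ^
(|ρ| + 1) + p ^ (|ρ| + k), so a code is made by appending zeros to a free string ρ, and the side
branches ρ 0 ^ j 1 become free. Keeping only side branches of k-length at most N keeps the free
k-lengths distinct. The price is that a request of weight p ^ N may use up p ^ N / (1 - p); the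
bound 1 - p on the total weight pays for this factor. -/

/-! ### Cylinders and the Kraft inequality -/

/-- The sequences extending `σ`. -/
def cylinder (σ : List Bool) : Set (ℕ → Bool) := {X | initSeg X σ.length = σ}

@[simp] lemma length_initSeg (X : ℕ → Bool) (n : ℕ) : (initSeg X n).length = n := by
  simp [initSeg]

lemma take_initSeg (X : ℕ → Bool) {m n : ℕ} (h : m ≤ n) :
    (initSeg X n).take m = initSeg X m := by
  simp [initSeg, ← List.map_take, List.take_range, h]

lemma initSeg_prefix (X : ℕ → Bool) {m n : ℕ} (h : m ≤ n) : initSeg X m <+: initSeg X n := by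
  rw [← take_initSeg X h]
  exact List.take_prefix _ _

lemma measurableSet_cylinder (σ : List Bool) : MeasurableSet (cylinder σ) := by
  have : cylinder σ = ⋂ i : Fin σ.length, {X : ℕ → Bool | X i = σ[i]} := by
    ext X
    simp [cylinder, initSeg, List.ext_getElem_iff, Fin.forall_iff]
  rw [this]
  refine MeasurableSet.iInter fun i => ?_
  exact measurableSet_eq_fun (measurable_pi_apply _) measurable_const

lemma openSet_eq_iUnion (S : Set (List Bool)) : openSet S = ⋃ σ : S, cylinder σ := by
  ext X
  simp only [openSet, cylinder, Set.mem_iUnion, Set.mem_ofPred_eq]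
  constructor
  · rintro ⟨n, hn⟩
    exact ⟨⟨_, hn⟩, by simp⟩
  · rintro ⟨⟨σ, hσ⟩, h⟩
    exact ⟨σ.length, by rwa [h]⟩

lemma disjoint_cylinder {σ τ : List Bool} (h₁ : ¬σ <+: τ) (h₂ : ¬τ <+: σ) :
    Disjoint (cylinder σ) (cylinder τ) := by
  refine Set.disjoint_left.2 fun X hσ hτ => ?_
  simp only [cylinder, Set.mem_ofPred_eq] at hσ hτ
  rcases le_total σ.length τ.length with h | h
  · exact h₁ (hσ ▸ hτ ▸ initSeg_prefix X h)
  · exact h₂ (hσ ▸ hτ ▸ initSeg_prefix X h)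

lemma measure_openSet_of_isPrefixFree (μ : Measure (ℕ → Bool)) {S : Set (List Bool)}
    (hS : IsPrefixFree S) : μ (openSet S) = ∑' σ : S, μ (cylinder σ) := by
  rw [openSet_eq_iUnion]
  refine measure_iUnion (fun σ τ hne => disjoint_cylinder ?_ ?_)
    fun σ => measurableSet_cylinder σ
  · exact fun h => hne (Subtype.ext (hS _ σ.2 _ τ.2 h))
  · exact fun h => hne (Subtype.ext (hS _ τ.2 _ σ.2 h)).symm

lemma lambdaMeasure_cylinder' (k : ℕ) (hk : 1 ≤ k) (σ : List Bool) :
    lambdaMeasure k hk (cylinder σ) = ENNReal.ofReal (pRoot k hk) ^ kLength k σ :=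
  lambdaMeasure_cylinder k hk σ

lemma tsum_pow_kLength_of_isPrefixFree (k : ℕ) (hk : 1 ≤ k) {S : Set (List Bool)}
    (hS : IsPrefixFree S) : ∑' σ : S, ENNReal.ofReal (pRoot k hk) ^ kLength k σ =
      lambdaMeasure k hk (openSet S) := by
  simp [measure_openSet_of_isPrefixFree _ hS, lambdaMeasure_cylinder']

lemma lambdaMeasure_openSet_le (k : ℕ) (hk : 1 ≤ k) (S : Set (List Bool)) :
    lambdaMeasure k hk (openSet S) ≤
      ∑' σ : S, ENNReal.ofReal (pRoot k hk) ^ kLength k σ := by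
  rw [openSet_eq_iUnion]
  refine (measure_iUnion_le _).trans_eq ?_
  simp [lambdaMeasure_cylinder']

instance (k : ℕ) (hk : 1 ≤ k) : IsProbabilityMeasure (lambdaMeasure k hk) := by
  unfold lambdaMeasure
  infer_instance

/-! ### Deficiency of complexity gives a test -/

lemma rePred_exists {α : Type*} [Primcodable α] {p : α → ℕ → Prop} [∀ a n, Decidable (p a n)]
    (hp : PrimrecRel p) : REPred fun a => ∃ n, p a n := by
  have hc : Computable₂ fun a n => decide (p a n) := hp.decide.to_comp
  refine (Partrec.rfind hc.partrec₂).dom_re.of_eq fun a => ?_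
  simp

lemma kLength_primrec (k : ℕ) : Primrec (kLength k) := by
  have hcount : ∀ b : Bool, Primrec fun σ : List Bool => σ.count b := fun b =>
    (Primrec.list_length.comp (Primrec.listFilter (p := fun a => a = b)
      (Primrec.eq.comp .id (.const b)))).of_eq fun σ => by
        rw [List.count, List.countP_eq_length_filter]
        congr 2
  exact Primrec.nat_add.comp (hcount false) (Primrec.nat_mul.comp (.const k) (hcount true))

@[simp] lemma kLength_append (k : ℕ) (σ τ : List Bool) :
    kLength k (σ ++ τ) = kLength k σ + kLength k τ := by
  simp [kLength]
  ring

/-- The outputs whose `k`-length exceeds that of some input by more than `d`. -/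
def compressible (k : ℕ) (M : List Bool →. List Bool) (d : ℕ) : Set (List Bool) :=
  {σ | ∃ τ, σ ∈ M τ ∧ kLength k τ + d < kLength k σ}

lemma rePred_compressible (k a : ℕ) {M : List Bool →. List Bool} (hM : Partrec M) :
    REPred fun q : ℕ × List Bool => q.2 ∈ compressible k M (a * q.1) := by
  obtain ⟨c, hc⟩ := Code.exists_code.1 hM
  have he : (Denumerable.ofNat Code (encode c)).eval =
      fun n => Part.bind (decode (α := List Bool) n) fun a => (M a).map encode := by
    rw [Denumerable.ofNat_encode]; exact hc
  let f : ℕ × List Bool → ℕ → Bool := fun q n =>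
    ((codeEvent (encode c) n).map fun e =>
      decide (e.2 = q.2) && decide (kLength k e.1 + a * q.1 < kLength k q.2)).getD false
  have hf : Primrec₂ f := by
    refine Primrec.option_getD.comp (Primrec.option_map
      (codeEvent_primrec.comp (.const _) .snd) ?_) (.const false)
    refine Primrec.and.comp (Primrec.eq.decide.comp (Primrec.snd.comp .snd)
      (Primrec.snd.comp (Primrec.fst.comp .fst))) (Primrec.nat_lt.decide.comp
      (Primrec.nat_add.comp ((kLength_primrec k).comp (Primrec.fst.comp .snd))
        (Primrec.nat_mul.comp (.const a) (Primrec.fst.comp (Primrec.fst.comp .fst))))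
      ((kLength_primrec k).comp (Primrec.snd.comp (Primrec.fst.comp .fst))))
  have hp : PrimrecRel fun q n => f q n = true := Primrec.eq.comp hf (.const true)
  refine (rePred_exists hp).of_eq fun q => ?_
  constructor
  · rintro ⟨n, hn⟩
    cases h : codeEvent (encode c) n with
    | none => simp [f, h] at hn
    | some e =>
      simp only [f, h, Option.map_some, Option.getD_some, Bool.and_eq_true, decide_eq_true_eq] at hn
      exact ⟨e.1, hn.1 ▸ codeEvent_sound he h, hn.2⟩
  · rintro ⟨τ, hτ, hlt⟩
    obtain ⟨n, hn⟩ := codeEvent_complete he hτ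
    exact ⟨n, by simp [f, hn, hlt]⟩

/-- Choosing a short description for each compressible string is injective, because a description
has only one output. The Kraft sum of the domain then bounds the total weight, and the saving d
contributes the factor p ^ d. -/
lemma lambdaMeasure_compressible_le (k : ℕ) (hk : 1 ≤ k) {M : List Bool →. List Bool}
    (hM : IsPrefixFree M.Dom) (d : ℕ) :
    lambdaMeasure k hk (openSet (compressible k M d)) ≤ ENNReal.ofReal (pRoot k hk) ^ d := by
  have hp := pRoot_mem_Ioo k hk
  set q := ENNReal.ofReal (pRoot k hk)
  have hq : q ≤ 1 := by simpa [q] using hp.2.le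
  choose g hg hlt using fun σ : compressible k M d => σ.2
  let G : compressible k M d → M.Dom := fun σ => ⟨g σ, Part.dom_iff_mem.2 ⟨_, hg σ⟩⟩
  have hG : Function.Injective G := by
    intro σ σ' h
    have h' : g σ = g σ' := congrArg Subtype.val h
    exact Subtype.ext (Part.mem_unique (hg σ) (h' ▸ hg σ'))
  calc lambdaMeasure k hk (openSet (compressible k M d))
      ≤ ∑' σ : compressible k M d, q ^ kLength k σ := lambdaMeasure_openSet_le k hk _
    _ ≤ ∑' σ : compressible k M d, q ^ d * q ^ kLength k (G σ) := by
        refine ENNReal.tsum_le_tsum fun σ => ?_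
        rw [← pow_add]
        exact pow_le_pow_right_of_le_one' hq (by have := hlt σ; simp only [G]; omega)
    _ = q ^ d * ∑' σ : compressible k M d, q ^ kLength k (G σ) := ENNReal.tsum_mul_left
    _ ≤ q ^ d * ∑' τ : M.Dom, q ^ kLength k τ := by
        gcongr
        exact ENNReal.tsum_comp_le_tsum_of_injective hG fun τ : M.Dom => q ^ kLength k τ
    _ ≤ q ^ d * 1 := by
        gcongr
        rw [tsum_pow_kLength_of_isPrefixFree k hk hM]
        exact prob_le_one
    _ = q ^ d := mul_one _

lemma exists_pow_pRoot_le (k : ℕ) (hk : 1 ≤ k) :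
    ∃ a : ℕ, ENNReal.ofReal (pRoot k hk) ^ a ≤ 2⁻¹ := by
  have hp := pRoot_mem_Ioo k hk
  obtain ⟨a, ha⟩ := exists_pow_lt_of_lt_one (by norm_num : (0 : ℝ) < 2⁻¹) hp.2
  refine ⟨a, ?_⟩
  rw [← ENNReal.ofReal_pow hp.1.le, ← ENNReal.ofReal_ofNat, ← ENNReal.ofReal_inv_of_pos two_pos]
  exact ENNReal.ofReal_le_ofReal ha.le

lemma kComplexity_le {k : ℕ} {U : List Bool →. List Bool} {σ τ : List Bool} (h : σ ∈ U τ) :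
    kComplexity k U σ ≤ kLength k τ :=
  iInf₂_le τ h

lemma exists_of_kComplexity_lt {k c m : ℕ} {U : List Bool →. List Bool} {σ : List Bool}
    (h : kComplexity k U σ + c < m) : ∃ τ, σ ∈ U τ ∧ kLength k τ + c < m := by
  by_contra! hc
  refine h.not_ge ?_
  have h' : ((m - c : ℕ) : ℕ∞) ≤ kComplexity k U σ :=
    le_iInf₂ fun τ hτ => by have := hc τ hτ; exact_mod_cast (by omega)
  calc (m : ℕ∞) ≤ ((m - c : ℕ) : ℕ∞) + c := by exact_mod_cast (by omega)
    _ ≤ _ := by gcongr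

lemma IsMLRandom.exists_le_kComplexity {k : ℕ} {hk : 1 ≤ k} {U : List Bool →. List Bool}
    (hU : IsPrefixFreeMachine U) {X : ℕ → Bool} (hX : IsMLRandom (lambdaMeasure k hk) X) :
    ∃ c : ℕ, ∀ n : ℕ, (kLength k (initSeg X n) : ℕ∞) ≤
      kComplexity k U (initSeg X n) + (c : ℕ∞) := by
  obtain ⟨a, ha⟩ := exists_pow_pRoot_le k hk
  by_contra! hc
  -- The factor a turns the bound p ^ (a * c) into at most 2⁻¹ ^ c, as a test requires.
  refine hX (fun c => openSet (compressible k U (a * c)))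
    ⟨⟨fun c => compressible k U (a * c), rePred_compressible k a hU.partrec, fun _ => rfl⟩,
      fun c => ?_⟩ (Set.mem_iInter.2 fun c => ?_)
  · refine (lambdaMeasure_compressible_le k hk hU.prefixFree _).trans ?_
    rw [pow_mul]
    gcongr
  · obtain ⟨n, hn⟩ := hc (a * c)
    exact ⟨n, exists_of_kComplexity_lt hn⟩

/-! ### Online allocation of strings of prescribed `k`-length -/

/-- Neither string extends the other. -/
def Incomparable (σ τ : List Bool) : Prop := ¬σ <+: τ ∧ ¬τ <+: σ

lemma Incomparable.symm {σ τ : List Bool} (h : Incomparable σ τ) : Incomparable τ σ := ⟨h.2, h.1⟩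

lemma Incomparable.ne {σ τ : List Bool} (h : Incomparable σ τ) : σ ≠ τ := by
  rintro rfl
  exact h.1 List.prefix_rfl

lemma Incomparable.mono {σ τ σ' τ' : List Bool} (h : Incomparable σ τ) (hσ : σ <+: σ')
    (hτ : τ <+: τ') : Incomparable σ' τ' := by
  constructor <;> intro h'
  · rcases List.prefix_or_prefix_of_prefix (hσ.trans h') hτ with h'' | h''
    exacts [h.1 h'', h.2 h'']
  · rcases List.prefix_or_prefix_of_prefix hσ (hτ.trans h') with h'' | h''
    exacts [h.1 h'', h.2 h'']

lemma incomparable_append (ρ : List Bool) {i j : ℕ} (h : i < j) :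
    Incomparable (ρ ++ List.replicate i false ++ [true]) (ρ ++ List.replicate j false) := by
  obtain ⟨t, rfl⟩ := Nat.exists_eq_add_of_lt h
  have : ρ ++ List.replicate (i + t + 1) false =
      ρ ++ List.replicate i false ++ (false :: List.replicate t false) := by
    rw [add_assoc, List.replicate_add, List.append_assoc, List.replicate_succ]
  rw [this]
  constructor <;> rw [List.prefix_append_right_inj] <;> simp

/-- The strings `ρ 0 ^ j 1` for `j < e`, in decreasing order of `j`. -/
def siblings (ρ : List Bool) (e : ℕ) : List (List Bool) :=
  (List.range e).reverse.map fun j => ρ ++ List.replicate j false ++ [true]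

lemma mem_siblings {ρ σ : List Bool} {e : ℕ} :
    σ ∈ siblings ρ e ↔ ∃ j < e, ρ ++ List.replicate j false ++ [true] = σ := by
  simp [siblings]

/-- The string of `k`-length `N` allocated when the list of free strings is `F`. -/
def allocated (k : ℕ) (F : List (List Bool)) (N : ℕ) : Option (List Bool) :=
  (F.filter (kLength k · ≤ N)).head?.map fun ρ => ρ ++ List.replicate (N - kLength k ρ) false

/-- The free strings after the allocation. -/
def remaining (k : ℕ) (F : List (List Bool)) (N : ℕ) : List (List Bool) :=
  ((F.filter (kLength k · ≤ N)).head?.map fun ρ =>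
    F.filter (N < kLength k ·) ++ (siblings ρ (N + 1 - kLength k ρ - k) ++
      (F.filter (kLength k · ≤ N)).tail)).getD F

/-- The strings in `F` are pairwise incomparable and listed in decreasing order of `k`-length. -/
def IsFreeList (k : ℕ) (F : List (List Bool)) : Prop :=
  F.Pairwise fun σ τ => kLength k τ < kLength k σ ∧ Incomparable σ τ

/-- The sum of `p ^ kLength k σ` over the members `σ` of `F`. -/
def weight (k : ℕ) (p : ℝ) (F : List (List Bool)) : ℝ := (F.map fun σ => p ^ kLength k σ).sum

/-- As k-lengths decrease, the two filters are consecutive blocks. The head of the second block is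
thus the longest free string that can still be extended to k-length N. -/
lemma IsFreeList.eq_append {k : ℕ} {F : List (List Bool)} (hF : IsFreeList k F) (N : ℕ) :
    F = F.filter (N < kLength k ·) ++ F.filter (kLength k · ≤ N) := by
  induction F with
  | nil => rfl
  | cons σ F ih =>
    obtain ⟨h₁, h₂⟩ := List.pairwise_cons.1 hF
    by_cases h : N < kLength k σ
    · simpa [h, h.not_ge] using ih h₂
    · have h3 : ∀ τ ∈ F, kLength k τ ≤ N := fun τ hτ => by have := (h₁ τ hτ).1; omega
      have h4 : F.filter (N < kLength k ·) = [] := by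
        simpa using h3
      have h5 : F.filter (kLength k · ≤ N) = F := by simpa using h3
      simp [h, not_lt.1 h, h4, h5]

@[simp] lemma kLength_replicate_false (k n : ℕ) : kLength k (List.replicate n false) = n := by
  simp [kLength, List.count_replicate]

@[simp] lemma kLength_singleton_true (k : ℕ) : kLength k [true] = k := by simp [kLength]

lemma kLength_sibling (k : ℕ) (ρ : List Bool) (j : ℕ) :
    kLength k (ρ ++ List.replicate j false ++ [true]) = kLength k ρ + j + k := by
  simp [add_assoc]

lemma isFreeList_siblings (k : ℕ) (ρ : List Bool) (e : ℕ) : IsFreeList k (siblings ρ e) := by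
  rw [IsFreeList, siblings, List.pairwise_map, List.pairwise_reverse]
  refine List.pairwise_lt_range.imp fun {i j} h => ⟨by simp [h], ?_⟩
  exact ((incomparable_append ρ h).mono List.prefix_rfl (List.prefix_append _ _)).symm

lemma weight_append (k : ℕ) (p : ℝ) (F G : List (List Bool)) :
    weight k p (F ++ G) = weight k p F + weight k p G := by
  simp [weight]

/-- The sum telescopes: p ^ (|ρ| + j + k) = p ^ (|ρ| + j) - p ^ (|ρ| + j + 1) because p ^ k = 1 - p.
-/
lemma weight_siblings (k : ℕ) {p : ℝ} (hp : p ^ k + p - 1 = 0) (ρ : List Bool) (e : ℕ) :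
    weight k p (siblings ρ e) = p ^ kLength k ρ - p ^ (kLength k ρ + e) := by
  have hk : p ^ k = 1 - p := by linarith
  rw [weight, siblings, List.map_map, List.map_reverse, List.sum_reverse]
  induction e with
  | zero => simp
  | succ e ih =>
    rw [List.range_succ, List.map_append, List.sum_append, ih]
    simp only [List.map_cons, List.map_nil, List.sum_cons, List.sum_nil, Function.comp_apply,
      kLength_sibling]
    rw [pow_add _ _ k, hk]
    ring

/-- The k-lengths are distinct, so the weight is dominated by the geometric series starting at p ^
N. -/
lemma weight_le (k : ℕ) {p : ℝ} (h0 : 0 < p) (h1 : p < 1) {F : List (List Bool)}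
    (hF : IsFreeList k F) {N : ℕ} (hN : ∀ σ ∈ F, N ≤ kLength k σ) :
    weight k p F ≤ p ^ N / (1 - p) := by
  -- The geometric sum is cut off after the longest string, the head; this sharper form supports the
  -- induction.
  have key : (1 - p) * weight k p F ≤ p ^ N - (F.head?.elim (p ^ N) fun σ => p ^ (kLength k σ + 1)) := by
    induction F with
    | nil => simp [weight]
    | cons σ F ih =>
      obtain ⟨h₁, h₂⟩ := List.pairwise_cons.1 hF
      have ih := ih h₂ fun τ hτ => hN τ (List.mem_cons_of_mem _ hτ)
      have hσ := hN σ List.mem_cons_self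
      have hle : p ^ kLength k σ ≤ F.head?.elim (p ^ N) fun σ => p ^ (kLength k σ + 1) := by
        cases F with
        | nil => exact pow_le_pow_of_le_one h0.le h1.le hσ
        | cons τ F => exact pow_le_pow_of_le_one h0.le h1.le (h₁ τ List.mem_cons_self).1
      have hw : weight k p (σ :: F) = p ^ kLength k σ + weight k p F := by simp [weight]
      rw [hw]
      simp only [List.head?_cons, Option.elim_some, pow_succ]
      linarith
  rw [le_div_iff₀ (by linarith)]
  have : 0 ≤ F.head?.elim (p ^ N) fun σ => p ^ (kLength k σ + 1) := by
    cases F <;> simp <;> positivity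
  linarith

/-- The effect of a successful allocation. -/
structure IsAllocation (k : ℕ) (F : List (List Bool)) (N : ℕ) (τ : List Bool)
    (F' : List (List Bool)) : Prop where
  kLength_eq : kLength k τ = N
  isFreeList : IsFreeList k F'
  incomparable : ∀ σ ∈ F', Incomparable τ σ
  exists_prefix : ∃ ρ ∈ F, ρ <+: τ
  exists_prefix' : ∀ σ ∈ F', ∃ ρ ∈ F, ρ <+: σ

/-- The retained side branches have k-length between |ρ| + k and N. No other free string has
k-length between |ρ| and N, by the choice of ρ, so they fit between the two blocks of F. Only the
weight p ^ (|ρ| + e) left by the telescoping sum is lost. -/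
lemma isAllocation_and_weight {k : ℕ} {p : ℝ} (h0 : 0 < p) (h1 : p < 1) (hp : p ^ k + p - 1 = 0)
    {F : List (List Bool)} (hF : IsFreeList k F) {N : ℕ} {τ : List Bool}
    (hτ : allocated k F N = some τ) :
    IsAllocation k F N τ (remaining k F N) ∧
      weight k p F - p ^ N / (1 - p) ≤ weight k p (remaining k F N) := by
  have hF0 := hF.eq_append N
  cases hB : F.filter (kLength k · ≤ N) with
  | nil => simp [allocated, hB] at hτ
  | cons ρ B =>
    have hτ' : ρ ++ List.replicate (N - kLength k ρ) false = τ := by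
      simpa [allocated, hB] using hτ
    have hrem : remaining k F N = F.filter (N < kLength k ·) ++
        (siblings ρ (N + 1 - kLength k ρ - k) ++ B) := by
      simp [remaining, hB]
    rw [hB] at hF0
    have hA : ∀ σ ∈ F.filter (N < kLength k ·), N < kLength k σ := fun σ hσ => by
      simpa using (List.mem_filter.1 hσ).2
    have hρN : kLength k ρ ≤ N := by
      have : ρ ∈ F.filter (kLength k · ≤ N) := by simp [hB]
      simpa using (List.mem_filter.1 this).2
    generalize F.filter (N < kLength k ·) = A at *
    set e := N + 1 - kLength k ρ - k with he
    subst hF0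
    obtain ⟨hpA, hpB, hAB⟩ := List.pairwise_append.1 hF
    obtain ⟨hρB, hpB⟩ := List.pairwise_cons.1 hpB
    have hsib : ∀ σ ∈ siblings ρ e, ρ <+: σ ∧ kLength k ρ < kLength k σ + 1 ∧
        kLength k ρ + k ≤ kLength k σ ∧ kLength k σ ≤ N := by
      intro σ hσ
      obtain ⟨j, hj, rfl⟩ := mem_siblings.1 hσ
      rw [kLength_sibling, List.append_assoc]
      exact ⟨List.prefix_append _ _, by omega, by omega, by omega⟩
    have hρτ : ρ <+: τ := hτ' ▸ List.prefix_append _ _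
    rw [hrem]
    refine ⟨⟨?_, ?_, ?_, ⟨ρ, by simp, hρτ⟩, ?_⟩, ?_⟩
    · rw [← hτ']
      simp
      omega
    · refine List.pairwise_append.2 ⟨hpA, List.pairwise_append.2
        ⟨isFreeList_siblings k ρ e, hpB, fun σ hσ β hβ => ?_⟩, fun α hα σ hσ => ?_⟩
      · obtain ⟨h₁, -, h₂, -⟩ := hsib σ hσ
        have := hρB β hβ
        exact ⟨by omega, this.2.mono h₁ List.prefix_rfl⟩
      · rcases List.mem_append.1 hσ with hσ | hσ
        · obtain ⟨h₁, -, -, h₂⟩ := hsib σ hσ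
          have := hA α hα
          exact ⟨by omega, (hAB α hα ρ (by simp)).2.mono List.prefix_rfl h₁⟩
        · exact hAB α hα σ (List.mem_cons_of_mem _ hσ)
    · intro σ hσ
      rcases List.mem_append.1 hσ with hσ | hσ
      · exact ((hAB σ hσ ρ (by simp)).2.mono List.prefix_rfl hρτ).symm
      rcases List.mem_append.1 hσ with hσ | hσ
      · obtain ⟨j, hj, rfl⟩ := mem_siblings.1 hσ
        -- Positivity of k gives j < N - |ρ|, so the side branch really leaves the path to τ; the
        -- equation for p rules out k = 0.
        by_cases hk : k = 0
        · subst hk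
          norm_num at hp
          exact absurd hp h0.ne'
        · rw [← hτ']
          exact (incomparable_append ρ (by omega)).symm
      · exact (hρB σ hσ).2.mono hρτ List.prefix_rfl
    · intro σ hσ
      rcases List.mem_append.1 hσ with hσ | hσ
      · exact ⟨σ, by simp [hσ], List.prefix_rfl⟩
      rcases List.mem_append.1 hσ with hσ | hσ
      · exact ⟨ρ, by simp, (hsib σ hσ).1⟩
      · exact ⟨σ, by simp [hσ], List.prefix_rfl⟩
    · have hw : weight k p (ρ :: B) = p ^ kLength k ρ + weight k p B := by simp [weight]
      rw [weight_append, weight_append, weight_append, weight_siblings k hp, hw]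
      have hk : p ^ k = 1 - p := by linarith
      -- Dividing by 1 - p = p ^ k lowers the exponent by k, and |ρ| + e + k ≥ N even when the
      -- subtraction in e truncates.
      have : p ^ (kLength k ρ + e) ≤ p ^ N / (1 - p) := by
        rw [le_div_iff₀ (by linarith), ← hk, ← pow_add]
        exact pow_le_pow_of_le_one h0.le h1.le (by omega)
      linarith

lemma weight_le_of_allocated_eq_none {k : ℕ} {p : ℝ} (h0 : 0 < p) (h1 : p < 1)
    {F : List (List Bool)} (hF : IsFreeList k F) {N : ℕ} (h : allocated k F N = none) :
    weight k p F ≤ p ^ N / (1 - p) := by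
  refine weight_le k h0 h1 hF fun σ hσ => ?_
  simp only [allocated, Option.map_eq_none_iff, List.head?_eq_none_iff, List.filter_eq_nil_iff,
    decide_eq_true_eq, not_le] at h
  exact (h σ hσ).le

/-! ### The Kraft–Chaitin theorem for the `k`-length -/

/-- The free strings after the first `n` requests; a request `(σ, N)` asks for a code of `σ` of
`k`-length `N`. -/
def freeList (k : ℕ) (r : ℕ → Option (List Bool × ℕ)) (n : ℕ) : List (List Bool) :=
  n.rec [[]] fun n F => ((r n).map fun q => remaining k F q.2).getD F

/-- The code chosen for the `n`-th request. -/
def codeword (k : ℕ) (r : ℕ → Option (List Bool × ℕ)) (n : ℕ) : Option (List Bool) :=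
  (r n).bind fun q => allocated k (freeList k r n) q.2

/-- The weight of a request. -/
def requestWeight (p : ℝ) (o : Option (List Bool × ℕ)) : ℝ := o.elim 0 fun q => p ^ q.2

lemma freeList_succ (k : ℕ) (r : ℕ → Option (List Bool × ℕ)) (n : ℕ) :
    freeList k r (n + 1) =
      ((r n).map fun q => remaining k (freeList k r n) q.2).getD (freeList k r n) := rfl

section KraftChaitin

variable {k : ℕ} {p : ℝ} {r : ℕ → Option (List Bool × ℕ)}

/-- Failure would leave free weight at most p ^ N / (1 - p), but the weight invariant leaves
strictly more as long as the requests, including the present one, total less than 1 - p. -/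
lemma freeList_invariant (h0 : 0 < p) (h1 : p < 1) (hp : p ^ k + p - 1 = 0)
    (hr : ∀ n, ∑ j ∈ Finset.range n, requestWeight p (r j) < 1 - p) (n : ℕ) :
    IsFreeList k (freeList k r n) ∧
      1 - (∑ j ∈ Finset.range n, requestWeight p (r j)) / (1 - p) ≤
        weight k p (freeList k r n) ∧
      ∀ q, r n = some q → ∃ τ, allocated k (freeList k r n) q.2 = some τ ∧
        IsAllocation k (freeList k r n) q.2 τ (freeList k r (n + 1)) := by
  have step : ∀ n, IsFreeList k (freeList k r n) →
      1 - (∑ j ∈ Finset.range n, requestWeight p (r j)) / (1 - p) ≤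
        weight k p (freeList k r n) →
      ∀ q, r n = some q → ∃ τ, allocated k (freeList k r n) q.2 = some τ := by
    intro n hF hw q hq
    by_contra! hne
    have hnone := Option.eq_none_iff_forall_ne_some.2 hne
    have h₁ := weight_le_of_allocated_eq_none h0 h1 hF hnone
    have h₂ := hr (n + 1)
    rw [← div_lt_one (by linarith), Finset.sum_range_succ, hq, add_div] at h₂
    simp only [requestWeight, Option.elim_some] at h₂ hw
    linarith
  have hinv : ∀ n, IsFreeList k (freeList k r n) ∧
      1 - (∑ j ∈ Finset.range n, requestWeight p (r j)) / (1 - p) ≤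
        weight k p (freeList k r n) := by
    intro n
    induction n with
    | zero => exact ⟨List.pairwise_singleton _ _, by simp [weight, freeList, kLength]⟩
    | succ n ih =>
      cases hq : r n with
      | none => simpa [freeList_succ, hq, Finset.sum_range_succ, requestWeight] using ih
      | some q =>
        obtain ⟨τ, hτ⟩ := step n ih.1 ih.2 q hq
        obtain ⟨ha, hw⟩ := isAllocation_and_weight h0 h1 hp ih.1 hτ
        rw [freeList_succ, Finset.sum_range_succ, hq, add_div]
        exact ⟨ha.isFreeList, by
          simp only [requestWeight, Option.elim_some, Option.map_some, Option.getD_some] at ih ⊢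
          linarith [ih.2]⟩
  refine ⟨(hinv n).1, (hinv n).2, fun q hq => ?_⟩
  obtain ⟨τ, hτ⟩ := step n (hinv n).1 (hinv n).2 q hq
  refine ⟨τ, hτ, ?_⟩
  rw [freeList_succ, hq]
  exact (isAllocation_and_weight h0 h1 hp (hinv n).1 hτ).1

lemma exists_prefix_freeList (h0 : 0 < p) (h1 : p < 1) (hp : p ^ k + p - 1 = 0)
    (hr : ∀ n, ∑ j ∈ Finset.range n, requestWeight p (r j) < 1 - p) {m n : ℕ} (h : m ≤ n) :
    ∀ σ ∈ freeList k r n, ∃ ρ ∈ freeList k r m, ρ <+: σ := by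
  induction n, h using Nat.le_induction with
  | base => exact fun σ hσ => ⟨σ, hσ, List.prefix_rfl⟩
  | succ n _ ih =>
    intro σ hσ
    have : ∃ ρ ∈ freeList k r n, ρ <+: σ := by
      cases hq : r n with
      | none => exact ⟨σ, by simpa [freeList_succ, hq] using hσ, List.prefix_rfl⟩
      | some q =>
        obtain ⟨τ, -, hτ⟩ := (freeList_invariant h0 h1 hp hr n).2.2 q hq
        exact hτ.exists_prefix' σ hσ
    obtain ⟨ρ, hρ, h₁⟩ := this
    obtain ⟨ρ', hρ', h₂⟩ := ih ρ hρ
    exact ⟨ρ', hρ', h₂.trans h₁⟩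

lemma codeword_eq_some {n : ℕ} {τ : List Bool} (h : codeword k r n = some τ) :
    ∃ q, r n = some q ∧ allocated k (freeList k r n) q.2 = some τ := by
  simpa [codeword, Option.bind_eq_some_iff] using h

/-- The later code extends a string that was free just after stage m, and all of those are
incomparable with the code issued at stage m. -/
lemma incomparable_codeword (h0 : 0 < p) (h1 : p < 1) (hp : p ^ k + p - 1 = 0)
    (hr : ∀ n, ∑ j ∈ Finset.range n, requestWeight p (r j) < 1 - p) {m n : ℕ} (h : m < n)
    {σ τ : List Bool} (hσ : codeword k r m = some σ) (hτ : codeword k r n = some τ) :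
    Incomparable σ τ := by
  obtain ⟨q, hq, hσ⟩ := codeword_eq_some hσ
  obtain ⟨q', hq', hτ⟩ := codeword_eq_some hτ
  obtain ⟨σ', hσ', ha⟩ := (freeList_invariant h0 h1 hp hr m).2.2 q hq
  obtain ⟨τ', hτ', hb⟩ := (freeList_invariant h0 h1 hp hr n).2.2 q' hq'
  obtain rfl : σ' = σ := by simpa [hσ] using hσ'.symm
  obtain rfl : τ' = τ := by simpa [hτ] using hτ'.symm
  obtain ⟨ρ, hρ, h₁⟩ := hb.exists_prefix
  obtain ⟨ρ', hρ', h₂⟩ := exists_prefix_freeList h0 h1 hp hr h ρ hρ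
  exact (ha.incomparable ρ' hρ').mono List.prefix_rfl (h₂.trans h₁)

/-! ### Computability of the allocation -/

lemma replicate_primrec {α : Type*} [Primcodable α] (a : α) :
    Primrec fun n => List.replicate n a :=
  (Primrec.list_map .list_range (Primrec₂.const a)).of_eq fun n => by simp

lemma siblings_primrec : Primrec₂ siblings :=
  Primrec.list_map (Primrec.list_reverse.comp (Primrec.list_range.comp .snd))
    (Primrec.list_append.comp (Primrec.list_append.comp (Primrec.fst.comp .fst)
      ((replicate_primrec false).comp .snd)) (.const [true]))

lemma filter_kLength_le_primrec (k : ℕ) :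
    Primrec₂ fun (F : List (List Bool)) (N : ℕ) => F.filter (kLength k · ≤ N) :=
  PrimrecRel.listFilter (R := fun σ N => kLength k σ ≤ N)
    (Primrec.nat_le.comp ((kLength_primrec k).comp .fst) .snd)

lemma filter_lt_kLength_primrec (k : ℕ) :
    Primrec₂ fun (F : List (List Bool)) (N : ℕ) => F.filter (N < kLength k ·) :=
  PrimrecRel.listFilter (R := fun σ N => N < kLength k σ)
    (Primrec.nat_lt.comp .snd ((kLength_primrec k).comp .fst))

lemma allocated_primrec (k : ℕ) : Primrec₂ (allocated k) :=
  Primrec.option_map (Primrec.list_head?.comp (filter_kLength_le_primrec k))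
    (Primrec.list_append.comp .snd ((replicate_primrec false).comp
      (Primrec.nat_sub.comp (Primrec.snd.comp .fst) ((kLength_primrec k).comp .snd))))

lemma remaining_primrec (k : ℕ) : Primrec₂ (remaining k) := by
  refine Primrec.option_getD.comp (Primrec.option_map
    (Primrec.list_head?.comp (filter_kLength_le_primrec k)) ?_) .fst
  refine Primrec.list_append.comp ((filter_lt_kLength_primrec k).comp (Primrec.fst.comp .fst) (Primrec.snd.comp .fst))
    (Primrec.list_append.comp (siblings_primrec.comp .snd ?_)
      (Primrec.list_tail.comp ((filter_kLength_le_primrec k).comp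
        (Primrec.fst.comp .fst) (Primrec.snd.comp .fst))))
  exact Primrec.nat_sub.comp (Primrec.nat_sub.comp
    (Primrec.succ.comp (Primrec.snd.comp .fst)) ((kLength_primrec k).comp .snd)) (.const k)

lemma freeList_computable (hr : Computable r) : Computable (freeList k r) := by
  have hstep : Computable₂ fun (_ : ℕ) (q : ℕ × List (List Bool)) =>
      ((r q.1).map fun s => remaining k q.2 s.2).getD q.2 := by
    have h : Computable₂ fun (x : ℕ × ℕ × List (List Bool)) (s : List Bool × ℕ) =>
        remaining k x.2.2 s.2 :=
      (remaining_primrec k).to_comp.comp (Computable.snd.comp (Computable.snd.comp .fst))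
        (Computable.snd.comp .snd)
    exact Computable.option_getD (Computable.option_map
      (hr.comp (Computable.fst.comp .snd)) h) (Computable.snd.comp .snd)
  exact Computable.nat_rec (f := id) (g := fun _ => [[]]) .id (.const _) hstep

lemma codeword_computable (hr : Computable r) : Computable (codeword k r) := by
  refine Computable.option_bind hr ?_
  exact (allocated_primrec k).to_comp.comp ((freeList_computable hr).comp .fst)
    (Computable.snd.comp .snd)

/-- The Kraft–Chaitin theorem for the `k`-length: a computable sequence of requests of small total
weight is met by a prefix-free machine. -/
theorem exists_machine_of_requests (h0 : 0 < p) (h1 : p < 1) (hp : p ^ k + p - 1 = 0)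
    (hr : ∀ n, ∑ j ∈ Finset.range n, requestWeight p (r j) < 1 - p) (hc : Computable r) :
    ∃ M, IsPrefixFreeMachine M ∧
      ∀ n σ N, r n = some (σ, N) → ∃ τ, σ ∈ M τ ∧ kLength k τ = N := by
  let f : List Bool → ℕ → Option (List Bool) := fun τ n =>
    if codeword k r n = some τ then (r n).map Prod.fst else none
  have hf : Computable₂ f := by
    have h₁ : Computable fun q : List Bool × ℕ => decide (codeword k r q.2 = some q.1) :=
      (Primrec.eq (α := Option (List Bool))).decide.to_comp.comp
        ((codeword_computable hc).comp .snd) (Computable.option_some.comp .fst)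
    have h₂ : Computable fun q : List Bool × ℕ => (r q.2).map Prod.fst :=
      Computable.option_map (hc.comp .snd) (Computable.fst.comp .snd)
    exact (Computable.cond h₁ h₂ (.const none)).of_eq fun q => by simp [f, Bool.cond_decide]
  have hfs : ∀ {τ n σ}, f τ n = some σ → codeword k r n = some τ ∧ ∃ N, r n = some (σ, N) := by
    intro τ n σ h
    simp only [f, Option.ite_none_right_eq_some, Option.map_eq_some_iff] at h
    obtain ⟨h, ⟨σ', N⟩, h', rfl⟩ := h
    exact ⟨h, N, h'⟩
  refine ⟨fun τ => Nat.rfindOpt (f τ), ⟨Partrec.rfindOpt hf, ?_⟩, ?_⟩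
  · intro σ hσ τ hτ hpre
    obtain ⟨m, x, hm⟩ := Nat.rfindOpt_dom.1 hσ
    obtain ⟨n, y, hn⟩ := Nat.rfindOpt_dom.1 hτ
    have hm := (hfs hm).1
    have hn := (hfs hn).1
    rcases lt_trichotomy m n with h | rfl | h
    · exact absurd hpre (incomparable_codeword h0 h1 hp hr h hm hn).1
    · simpa [hm] using hn
    · exact absurd hpre (incomparable_codeword h0 h1 hp hr h hn hm).2
  · intro n σ N hn
    obtain ⟨τ, hτ, ha⟩ := (freeList_invariant h0 h1 hp hr n).2.2 _ hn
    have hcw : codeword k r n = some τ := by simp [codeword, hn, hτ]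
    refine ⟨τ, ?_, ha.kLength_eq⟩
    have hd : (Nat.rfindOpt (f τ)).Dom := Nat.rfindOpt_dom.2 ⟨n, σ, by simp [f, hcw, hn]⟩
    obtain ⟨x, hx⟩ := Part.dom_iff_mem.1 hd
    obtain ⟨m, hm⟩ := Nat.rfindOpt_spec hx
    obtain ⟨hm, N', hN'⟩ := hfs hm
    -- The search may halt at some other stage m, but no codeword is issued twice.
    obtain rfl : m = n := by
      by_contra hne
      rcases lt_or_gt_of_ne hne with h | h
      · exact (incomparable_codeword h0 h1 hp hr h hm hcw).ne rfl
      · exact (incomparable_codeword h0 h1 hp hr h hcw hm).ne rfl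
    obtain rfl : σ = x := by
      have := hn.symm.trans hN'
      simp_all
    exact hx

end KraftChaitin

/-! ### Prefix-free generators of effectively open sets -/

/-- Step-bounded evaluation is primitive recursive and monotone in the bound. -/
lemma exists_primrec_of_rePred {α : Type*} [Primcodable α] {p : α → Prop} (hp : REPred p) :
    ∃ D : α → ℕ → Bool, Primrec₂ D ∧ (∀ a, p a ↔ ∃ s, D a s = true) ∧
      ∀ a s t, s ≤ t → D a s = true → D a t = true := by
  obtain ⟨c, hc⟩ := Code.exists_code.1 hp
  refine ⟨fun a s => (Code.evaln s c (encode a)).isSome, ?_, fun a => ?_, fun a s t hst h => ?_⟩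
  · exact Primrec.option_isSome.comp (Code.primrec_evaln.comp
      (.pair (.pair .snd (.const c)) (Primrec.encode.comp .fst)))
  · have h : p a ↔ ∃ x, x ∈ Code.eval c (encode a) := by
      rw [hc]
      simp
    simp only [h, Code.evaln_complete, Option.isSome_iff_exists, Option.mem_def]
    exact exists_comm
  · obtain ⟨x, hx⟩ := Option.isSome_iff_exists.1 h
    exact Option.isSome_iff_exists.2 ⟨x, Code.evaln_mono hst hx⟩

/-- Some initial segment of `σ` is accepted by `D i` by stage `σ.length`. -/
def Covered (D : ℕ × List Bool → ℕ → Bool) (i : ℕ) (σ : List Bool) : Prop :=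
  ∃ n ∈ List.range (σ.length + 1), D (i, σ.take n) σ.length = true

/-- `σ` is covered and no proper initial segment of `σ` is. -/
def MinCovered (D : ℕ × List Bool → ℕ → Bool) (i : ℕ) (σ : List Bool) : Prop :=
  Covered D i σ ∧ ∀ n ∈ List.range σ.length, ¬Covered D i (σ.take n)

instance (D : ℕ × List Bool → ℕ → Bool) (i : ℕ) (σ : List Bool) : Decidable (Covered D i σ) := by
  unfold Covered
  infer_instance

instance (D : ℕ × List Bool → ℕ → Bool) (i : ℕ) (σ : List Bool) :
    Decidable (MinCovered D i σ) := by
  unfold MinCovered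
  infer_instance

section Covered

variable {D : ℕ × List Bool → ℕ → Bool}

lemma covered_primrec (hD : Primrec₂ D) : PrimrecRel (Covered D) := by
  have h : PrimrecRel fun (n : ℕ) (q : ℕ × List Bool) =>
      D (q.1, q.2.take n) q.2.length = true := by
    refine Primrec.eq.comp (hD.comp (.pair (Primrec.fst.comp .snd)
      (Primrec.list_take.comp .fst (Primrec.snd.comp .snd)))
      (Primrec.list_length.comp (Primrec.snd.comp .snd))) (.const true)
  exact h.exists_mem_list.comp
    (Primrec.list_range.comp (Primrec.succ.comp (Primrec.list_length.comp .snd))) .id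

lemma minCovered_primrec (hD : Primrec₂ D) : PrimrecRel (MinCovered D) := by
  have h : PrimrecRel fun (n : ℕ) (q : ℕ × List Bool) => ¬Covered D q.1 (q.2.take n) :=
    PrimrecPred.not ((covered_primrec hD).comp (Primrec.fst.comp .snd)
      (Primrec.list_take.comp .fst (Primrec.snd.comp .snd)))
  exact PrimrecPred.and (covered_primrec hD) (h.forall_mem_list.comp
    (Primrec.list_range.comp (Primrec.list_length.comp .snd)) .id)

lemma isPrefixFree_minCovered (D : ℕ × List Bool → ℕ → Bool) (i : ℕ) :
    IsPrefixFree {σ | MinCovered D i σ} := by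
  intro σ hσ τ hτ h
  by_contra hne
  have hlt : σ.length < τ.length :=
    lt_of_le_of_ne h.length_le fun hl => hne (h.eq_of_length hl)
  have := hτ.2 σ.length (List.mem_range.2 hlt)
  rw [← List.prefix_iff_eq_take.1 h] at this
  exact this hσ.1

/-- Tying the stage to the length makes coverage decidable, hence also minimality. It only delays
acceptance to longer initial segments, which leaves the open set unchanged. -/
lemma openSet_minCovered (hmono : ∀ a s t, s ≤ t → D a s = true → D a t = true)
    {R : ℕ → Set (List Bool)} (hR : ∀ q : ℕ × List Bool, q.2 ∈ R q.1 ↔ ∃ s, D q s = true)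
    (i : ℕ) : openSet {σ | MinCovered D i σ} = openSet (R i) := by
  ext X
  constructor
  · rintro ⟨n, ⟨m, hm, h⟩, -⟩
    rw [List.mem_range, length_initSeg] at hm
    rw [take_initSeg X (by omega)] at h
    exact ⟨m, (hR (i, _)).2 ⟨_, h⟩⟩
  · rintro ⟨n, hn⟩
    obtain ⟨s, hs⟩ := (hR (i, _)).1 hn
    have hex : ∃ m, Covered D i (initSeg X m) := by
      -- Long enough to contain the accepted segment and to allow s stages.
      refine ⟨max n s, n, by simp, ?_⟩
      rw [take_initSeg X (le_max_left _ _), length_initSeg]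
      exact hmono _ _ _ (le_max_right _ _) hs
    refine ⟨Nat.find hex, Nat.find_spec hex, fun m hm => ?_⟩
    rw [List.mem_range, length_initSeg] at hm
    rw [take_initSeg X hm.le]
    exact Nat.find_min hex hm

end Covered

/-! ### A test gives short descriptions -/

/-- A single cylinder already has measure at most p ^ (2 * i), so its string is long and the
subtraction of i is genuine. Half of the exponent 2 * i pays for shortening the codes by i; the
other half makes the sum over i converge. -/
lemma le_kLength_and_tsum_le (k : ℕ) (hk : 1 ≤ k) {S : Set (List Bool)} (hS : IsPrefixFree S)
    {i : ℕ} (hi : lambdaMeasure k hk (openSet S) ≤ ENNReal.ofReal (pRoot k hk) ^ (2 * i)) (C : ℕ) :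
    (∀ σ ∈ S, i ≤ kLength k σ) ∧
      ∑' σ : S, ENNReal.ofReal (pRoot k hk) ^ (kLength k σ + C - i) ≤
        ENNReal.ofReal (pRoot k hk) ^ C * ENNReal.ofReal (pRoot k hk) ^ i := by
  have hp := pRoot_mem_Ioo k hk
  rw [← tsum_pow_kLength_of_isPrefixFree k hk hS] at hi
  have hle : ∀ σ ∈ S, i ≤ kLength k σ := by
    intro σ hσ
    have h := (ENNReal.le_tsum (⟨σ, hσ⟩ : S)).trans hi
    rw [← ENNReal.ofReal_pow hp.1.le, ← ENNReal.ofReal_pow hp.1.le,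
      ENNReal.ofReal_le_ofReal_iff (pow_nonneg hp.1.le _),
      pow_le_pow_iff_right_of_lt_one₀ hp.1 hp.2] at h
    simp only at h
    omega
  refine ⟨hle, ?_⟩
  set q := ENNReal.ofReal (pRoot k hk)
  have hq0 : q ^ i ≠ 0 := pow_ne_zero _ (by simpa [q] using hp.1)
  have hqt : q ^ i ≠ ⊤ := ENNReal.pow_ne_top ENNReal.ofReal_ne_top
  rw [← ENNReal.mul_le_mul_iff_left hq0 hqt, ← ENNReal.tsum_mul_right]
  calc ∑' σ : S, q ^ (kLength k σ + C - i) * q ^ i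
      = ∑' σ : S, q ^ C * q ^ kLength k σ := by
        refine tsum_congr fun σ => ?_
        rw [← pow_add, ← pow_add]
        congr 1
        have := hle σ σ.2
        omega
    _ = q ^ C * ∑' σ : S, q ^ kLength k σ := ENNReal.tsum_mul_left
    _ ≤ q ^ C * q ^ (2 * i) := by gcongr
    _ = q ^ C * q ^ i * q ^ i := by ring

lemma exists_two_inv_pow_le (k : ℕ) (hk : 1 ≤ k) :
    ∃ b : ℕ, (2⁻¹ : ENNReal) ^ b ≤ ENNReal.ofReal (pRoot k hk) := by
  have hp := pRoot_mem_Ioo k hk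
  obtain ⟨b, hb⟩ := exists_pow_lt_of_lt_one hp.1 (by norm_num : (2⁻¹ : ℝ) < 1)
  refine ⟨b, ?_⟩
  rw [← ENNReal.ofReal_ofNat, ← ENNReal.ofReal_inv_of_pos two_pos, ← ENNReal.ofReal_pow (by simp)]
  exact ENNReal.ofReal_le_ofReal hb.le

/-- The `n`-th request: a pair `(i, σ)` with `σ` minimal for the component `g i` of the test asks
for a code of `σ` of `k`-length `kLength k σ + C - i`. -/
def request (k : ℕ) (D : ℕ × List Bool → ℕ → Bool) (g : ℕ → ℕ) (C n : ℕ) :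
    Option (List Bool × ℕ) :=
  (decode₂ (ℕ × List Bool) n).bind fun q =>
    if MinCovered D (g q.1) q.2 then some (q.2, kLength k q.2 + C - q.1) else none

lemma request_computable (k : ℕ) {D : ℕ × List Bool → ℕ → Bool} (hD : Primrec₂ D) {g : ℕ → ℕ}
    (hg : Primrec g) (C : ℕ) : Computable (request k D g C) := by
  refine Primrec.to_comp (Primrec.option_bind Primrec.decode₂ ?_)
  refine Primrec.ite ((minCovered_primrec hD).comp (hg.comp (Primrec.fst.comp .snd))
    (Primrec.snd.comp .snd))
    ?_ (.const none)
  exact Primrec.option_some.comp (.pair (Primrec.snd.comp .snd) (Primrec.nat_sub.comp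
    (Primrec.nat_add.comp ((kLength_primrec k).comp (Primrec.snd.comp .snd)) (.const C))
    (Primrec.fst.comp .snd)))

lemma request_encode (k : ℕ) (D : ℕ × List Bool → ℕ → Bool) (g : ℕ → ℕ) (C i : ℕ)
    (σ : List Bool) : request k D g C (encode (i, σ)) =
      if MinCovered D (g i) σ then some (σ, kLength k σ + C - i) else none := by
  simp only [request, encodek₂, Option.bind_some]

lemma tsum_requestWeight_le (k : ℕ) (hk : 1 ≤ k) (D : ℕ × List Bool → ℕ → Bool) (g : ℕ → ℕ)
    (C : ℕ) (hg : ∀ i, lambdaMeasure k hk (openSet {σ | MinCovered D (g i) σ}) ≤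
      ENNReal.ofReal (pRoot k hk) ^ (2 * i)) :
    ∑' n, ENNReal.ofReal (requestWeight (pRoot k hk) (request k D g C n)) ≤
      ENNReal.ofReal (pRoot k hk) ^ C * (1 - ENNReal.ofReal (pRoot k hk))⁻¹ := by
  have hp := pRoot_mem_Ioo k hk
  set q := ENNReal.ofReal (pRoot k hk) with hq
  let G : ℕ × List Bool → ENNReal := fun x =>
    Set.indicator {σ | MinCovered D (g x.1) σ} (fun σ => q ^ (kLength k σ + C - x.1)) x.2
  have hG : ∀ x, ENNReal.ofReal (requestWeight (pRoot k hk) (request k D g C (encode x))) =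
      G x := by
    rintro ⟨i, σ⟩
    simp only [request_encode, G, Set.indicator_apply, Set.mem_ofPred_eq]
    split_ifs
    · simp [requestWeight, hq, ENNReal.ofReal_pow hp.1.le]
    · simp [requestWeight]
  calc ∑' n, ENNReal.ofReal (requestWeight (pRoot k hk) (request k D g C n))
      = ∑' x, G x := by
        simp_rw [← hG]
        -- `decode₂` rejects numbers that are not codes, so only indices in the range of `encode`
        -- carry weight.
        refine (encode_injective.tsum_eq fun n hn => ?_).symm
        refine decode₂_ne_none_iff.1 fun h => hn ?_
        simp [request, h, requestWeight]
    _ = ∑' i, ∑' σ, G (i, σ) := ENNReal.tsum_prod'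
    _ ≤ ∑' i, q ^ C * q ^ i := by
        refine ENNReal.tsum_le_tsum fun i => ?_
        have := (le_kLength_and_tsum_le k hk (isPrefixFree_minCovered D (g i)) (hg i) C).2
        rwa [tsum_subtype {σ | MinCovered D (g i) σ}
          (fun σ => q ^ (kLength k σ + C - i))] at this
    _ = q ^ C * (1 - q)⁻¹ := by rw [ENNReal.tsum_mul_left, ENNReal.tsum_geometric]

lemma sum_requestWeight_lt (k : ℕ) (hk : 1 ≤ k) (D : ℕ × List Bool → ℕ → Bool) (g : ℕ → ℕ)
    {C : ℕ} (hC : pRoot k hk ^ C < (1 - pRoot k hk) ^ 2)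
    (hg : ∀ i, lambdaMeasure k hk (openSet {σ | MinCovered D (g i) σ}) ≤
      ENNReal.ofReal (pRoot k hk) ^ (2 * i)) (n : ℕ) :
    ∑ j ∈ Finset.range n, requestWeight (pRoot k hk) (request k D g C j) < 1 - pRoot k hk := by
  have hp := pRoot_mem_Ioo k hk
  have hp1 : 0 < 1 - pRoot k hk := by linarith [hp.2]
  have hnn : ∀ o, 0 ≤ requestWeight (pRoot k hk) o := by
    rintro (_ | q)
    exacts [le_rfl, pow_nonneg hp.1.le _]
  have h := (ENNReal.sum_le_tsum (Finset.range n)).trans (tsum_requestWeight_le k hk D g C hg)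
  rw [← ENNReal.ofReal_sum_of_nonneg fun j _ => hnn _, ← ENNReal.ofReal_pow hp.1.le,
    ← ENNReal.ofReal_one, ← ENNReal.ofReal_sub _ hp.1.le, ← ENNReal.ofReal_inv_of_pos hp1,
    ← ENNReal.ofReal_mul (pow_nonneg hp.1.le _), ENNReal.ofReal_le_ofReal_iff (by
      have := hp.1; positivity), ← div_eq_mul_inv] at h
  refine h.trans_lt ?_
  -- The requests total at most p ^ C / (1 - p), hence the square in the condition on C.
  rw [div_lt_iff₀ hp1]
  linarith

lemma IsMLTest.exists_machine {k : ℕ} {hk : 1 ≤ k} {𝒰 : ℕ → Set (ℕ → Bool)}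
    (h𝒰 : IsMLTest (lambdaMeasure k hk) 𝒰) :
    ∃ (M : List Bool →. List Bool) (C : ℕ), IsPrefixFreeMachine M ∧ ∀ X ∈ ⋂ i, 𝒰 i, ∀ i,
      ∃ n τ, initSeg X n ∈ M τ ∧ kLength k τ + i = kLength k (initSeg X n) + C := by
  have hp := pRoot_mem_Ioo k hk
  obtain ⟨R, hR, hU⟩ := h𝒰.sigma
  obtain ⟨D, hD, hRD, hmono⟩ := exists_primrec_of_rePred hR
  obtain ⟨b, hb⟩ := exists_two_inv_pow_le k hk
  obtain ⟨C, hC⟩ := exists_pow_lt_of_lt_one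
    (pow_pos (sub_pos.2 hp.2) 2 : (0 : ℝ) < (1 - pRoot k hk) ^ 2) hp.2
  -- Since 2⁻¹ ^ b ≤ p, component g i has measure at most p ^ (2 * i).
  let g : ℕ → ℕ := fun i => b * (2 * i)
  have hopen : ∀ i, openSet {σ | MinCovered D (g i) σ} = 𝒰 (g i) := fun i =>
    (openSet_minCovered hmono hRD _).trans (hU _).symm
  have hg : ∀ i, lambdaMeasure k hk (openSet {σ | MinCovered D (g i) σ}) ≤
      ENNReal.ofReal (pRoot k hk) ^ (2 * i) := by
    intro i
    rw [hopen]
    refine (h𝒰.measure_le _).trans ?_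
    rw [pow_mul]
    gcongr
  have hgp : Primrec g := Primrec.nat_mul.comp (.const b) (Primrec.nat_mul.comp (.const 2) .id)
  obtain ⟨M, hM, hreq⟩ := exists_machine_of_requests hp.1 hp.2 (pRoot_eq k hk)
    (sum_requestWeight_lt k hk D g hC hg) (request_computable k hD hgp C)
  refine ⟨M, C, hM, fun X hX i => ?_⟩
  obtain ⟨n, hn⟩ : X ∈ openSet {σ | MinCovered D (g i) σ} := by
    rw [hopen]
    exact Set.mem_iInter.1 hX _
  obtain ⟨τ, hτ, hl⟩ := hreq _ _ _ ((request_encode k D g C i _).trans (if_pos hn))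
  have := (le_kLength_and_tsum_le k hk (isPrefixFree_minCovered D (g i)) (hg i) C).1 _ hn
  exact ⟨n, τ, hτ, by omega⟩

lemma isMLRandom_of_le_kComplexity {k : ℕ} {hk : 1 ≤ k} {U : List Bool →. List Bool}
    (hU : IsUniversalPrefixFree U) {X : ℕ → Bool} {c : ℕ}
    (hX : ∀ n : ℕ, (kLength k (initSeg X n) : ℕ∞) ≤ kComplexity k U (initSeg X n) + (c : ℕ∞)) :
    IsMLRandom (lambdaMeasure k hk) X := by
  intro 𝒰 h𝒰 hmem
  obtain ⟨M, C, hM, h⟩ := h𝒰.exists_machine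
  obtain ⟨ρ, hρ⟩ := hU.universal M hM
  -- The saving must outweigh the coding string ρ, the overhead C and the constant c, with one to
  -- spare.
  obtain ⟨n, τ, hτ, hl⟩ := h X hmem (kLength k ρ + C + c + 1)
  have hUτ : initSeg X n ∈ U (ρ ++ τ) := by
    rwa [hρ τ (Part.dom_iff_mem.2 ⟨_, hτ⟩)]
  have h₁ := (hX n).trans (add_le_add_left (kComplexity_le (k := k) hUτ) (c : ℕ∞))
  rw [kLength_append] at h₁
  norm_cast at h₁
  omega

end KLength
end

theorem mainTheorem4 (k : ℕ) (hk : 1 ≤ k) (U : List Bool →. List Bool)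
    (hU : KLength.IsUniversalPrefixFree U) (X : ℕ → Bool) :
    KLength.IsMLRandom (KLength.lambdaMeasure k hk) X ↔
      ∃ c : ℕ, ∀ n : ℕ,
        (KLength.kLength k (KLength.initSeg X n) : ℕ∞) ≤
          KLength.kComplexity k U (KLength.initSeg X n) + (c : ℕ∞) :=
  ⟨fun h => h.exists_le_kComplexity hU.machine,
    fun ⟨_, hc⟩ => KLength.isMLRandom_of_le_kComplexity hU hc⟩
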